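/- Let $(X,*)$ be a commutative hypergroup on a second countable (hence $\sigma$-compact) locally compact Hausdorff space $X$, with identity $e$ and involution $x\mapsto\overline x$. Let $\alpha_0$ be a positive semicharacter on $(X,*)$, i.e. a continuous function $\alpha_0:X\to\,]0,\infty[$ with $\int\alpha_0\,d(\delta_x*\delta_y)=\alpha_0(x)\alpha_0(y)$ and $\alpha_0(\overline x)=\alpha_0(x)$ for all $x,y\in X$; no further growth condition on $\alpha_0$ is assumed. Let $(X,\bullet)$ be the deformation of $(X,*)$ with respect to $\alpha_0$, i.e. the commutative hypergroup with the same identity and involution and with $\delta_x\bullet\delta_y=\frac{1}{\alpha_0(x)\alpha_0(y)}\,\alpha_0\,(\delta_x*\delta_y)$. A convolution semigroup on a hypergroup is a family $(\mu_t)_{t\ge 0}$ of probability measures with $\mu_0=\delta_e$, with $\mu_{s+t}$ equal to the convolution of $\mu_s$ and $\mu_t$ for all $s,t\ge0$, and with $t\mapsto\mu_t$ weakly continuous. Its Lévy measure is the unique positive Radon measure $\eta$ on $X\setminus\{e\}$ with $\int f\,d\eta=\lim_{t\downarrow0}\frac1t\int f\,d\mu_t$ for all $f\in C_c(X)$ with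 $e\notin\operatorname{supp}f$. Write $M^1_{\alpha_0}(X)$ for the set of all probability measures $\mu$ on $X$ with $\int\alpha_0\,d\mu<\infty$, and $R_{\alpha_0}(\mu)=\left(\int\alpha_0\,d\mu\right)^{-1}\alpha_0\mu$ for such $\mu$. **Theorem.** Let $\rho$ be a bounded positive Borel measure on $X$ and let $\mu_t=e^{-t\|\rho\|}\exp(t\rho)=e^{-t\|\rho\|}\sum_{n\ge0}\frac{t^n}{n!}\rho^{(n)}$ for $t\ge0$, where $\rho^{(n)}$ is the $n$-th convolution power with respect to $*$ and $\rho^{(0)}=\delta_e$. Then $(\mu_t)_{t\ge0}$ is a convolution semigroup on $(X,*)$, its Lévy measure is (the restriction to $X\setminus\{e\}$ of) $\rho$, and the following statements are equivalent: 1. $\mu_t\in M^1_{\alpha_0}(X)$ for some $t>0$. 2. $\mu_t\in M^1_{\alpha_0}(X)$ for all $t\ge0$; the function $\varphi(t)=\int\alpha_0\,d\mu_t$ is a continuous map $[0,\infty[\,\to\,]0,\infty[$ with $\varphi(s+t)=\varphi(s)\varphi(t)$ for all $s,t\ge0$; and $(R_{\alpha_0}(\mu_t))_{t\ge0}$ is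 a convolution semigroup on $(X,\bullet)$. 3. For every neighborhood $U$ of $e$, $\int_{X\setminus U}\alpha_0\,d\rho<\infty$. -/

import Mathlib

open MeasureTheory Filter Topology TopologicalSpace
open scoped NNReal ENNReal ComplexConjugate

noncomputable section

/-- A commutative hypergroup structure on the space `X` (meant for `X` locally compact Hausdorff and
second countable, so that finite Borel measures are automatically regular). The convolution is given
by its values `conv x y` (the probability measure `δ_x * δ_y`) on point measures;
the convolution of bounded measures is the bilinear, weakly continuous extension
`μ * ν = ∫∫ δ_x * δ_y dμ(x) dν(y)`, see `CommHypergroup.convMeasure`.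
The space of compact sets carries the Michael (= Vietoris) topology. -/
structure CommHypergroup (X : Type*) [TopologicalSpace X] [MeasurableSpace X]
    [OpensMeasurableSpace X] where
  /-- `conv x y` is `δ_x * δ_y`. -/
  conv : X → X → ProbabilityMeasure X
  /-- The identity. -/
  one : X
  /-- The involution. -/
  inv : X → X
  continuous_conv : Continuous fun p : X × X => conv p.1 p.2
  isCompact_support : ∀ x y, IsCompact (conv x y : Measure X).support
  continuous_support : Continuous fun p : X × X =>
    (⟨(conv p.1 p.2 : Measure X).support, isCompact_support p.1 p.2⟩ : Compacts X)
  conv_comm : ∀ x y, conv x y = conv y x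
  conv_assoc : ∀ x y z,
    (conv x y : Measure X).bind (fun w => (conv w z : Measure X)) =
      (conv y z : Measure X).bind (fun w => (conv x w : Measure X))
  one_conv : ∀ x, (conv one x : Measure X) = Measure.dirac x
  continuous_inv : Continuous inv
  inv_inv : ∀ x, inv (inv x) = x
  map_inv_conv : ∀ x y, (conv x y : Measure X).map inv = (conv (inv y) (inv x) : Measure X)
  one_mem_support_iff : ∀ x y, one ∈ (conv x y : Measure X).support ↔ x = inv y

namespace CommHypergroup

set_option linter.unusedSectionVars false

section Basic

variable {X : Type*} [TopologicalSpace X] [MeasurableSpace X] [OpensMeasurableSpace X]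

/-- Semicharacters: continuous functions `α ≠ 0` with `α(x * y) = α(x) α(y)`, where
`α(x * y) = ∫ α d(δ_x * δ_y)`, and `α(x̄)` equal to the complex conjugate of `α(x)`. -/
structure IsSemicharacter (H : CommHypergroup X) (α : X → ℂ) : Prop where
  continuous : Continuous α
  ne_zero : α ≠ 0
  map_conv : ∀ x y, ∫ z, α z ∂(H.conv x y : Measure X) = α x * α y
  map_inv : ∀ x, α (H.inv x) = conj (α x)

/-- Positive semicharacters: semicharacters with values in `]0, ∞[`. -/
structure IsPositiveSemicharacter (H : CommHypergroup X) (α : X → ℝ) : Prop where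
  isSemicharacter : H.IsSemicharacter (fun x => (α x : ℂ))
  pos : ∀ x, 0 < α x

/-- The convolution `μ * ν` of bounded positive measures. -/
def convMeasure (H : CommHypergroup X) (μ ν : Measure X) : Measure X :=
  (μ.prod ν).bind fun p => (H.conv p.1 p.2 : Measure X)

/-- The convolution powers `μ^(n)`, with `μ^(0) = δ_e`. -/
def convPow (H : CommHypergroup X) (μ : Measure X) : ℕ → Measure X
  | 0 => Measure.dirac H.one
  | n + 1 => H.convMeasure (H.convPow μ n) μ

/-- The exponential `exp(μ) = ∑ μ^(n) / n!` of a bounded positive measure. All the terms are positive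
measures, so the sum of measures is the norm convergent sum. -/
def expMeasure (H : CommHypergroup X) (μ : Measure X) : Measure X :=
  Measure.sum fun n : ℕ => ((n.factorial : ℝ≥0∞)⁻¹) • H.convPow μ n

/-- The measure `e^{-t ‖ρ‖} exp(t ρ)`; the total variation norm of the positive measure `ρ` is its
total mass. -/
def poisson (H : CommHypergroup X) (ρ : Measure X) (t : ℝ≥0) : Measure X :=
  ENNReal.ofReal (Real.exp (-((t : ℝ) * ρ.real Set.univ))) • H.expMeasure (t • ρ)

/-- Convolution semigroups of probability measures, weakly continuous in `t ∈ [0, ∞[`. -/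
structure IsConvolutionSemigroup (H : CommHypergroup X) (μ : ℝ≥0 → Measure X) : Prop where
  isProbabilityMeasure : ∀ t, IsProbabilityMeasure (μ t)
  zero : μ 0 = Measure.dirac H.one
  add : ∀ s t, μ (s + t) = H.convMeasure (μ s) (μ t)
  continuous : ∀ f : BoundedContinuousFunction X ℝ, Continuous fun t => ∫ x, f x ∂(μ t)

/-- `η` is the Lévy measure of `(μ_t)`. Radon measures on `X \ {e}` are regarded as measures on `X`
which do not charge `e` and are finite on the compact sets not containing `e`. -/
structure IsLevyMeasure (H : CommHypergroup X) (μ : ℝ≥0 → Measure X) (η : Measure X) : Prop where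
  apply_one : η {H.one} = 0
  apply_lt_top : ∀ K : Set X, IsCompact K → H.one ∉ K → η K < ∞
  tendsto : ∀ f : X → ℝ, Continuous f → HasCompactSupport f → H.one ∉ tsupport f →
    Tendsto (fun t : ℝ≥0 => (t : ℝ)⁻¹ * ∫ x, f x ∂(μ t)) (𝓝[>] 0) (𝓝 (∫ x, f x ∂η))

end Basic

section Weight

variable {X : Type*} [MeasurableSpace X]

/-- The measure `α μ` for a nonnegative function `α`. -/
def weight (α : X → ℝ) (μ : Measure X) : Measure X :=
  μ.withDensity fun x => ENNReal.ofReal (α x)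

/-- `μ ∈ M^1_α(X)`: `μ` is a probability measure and `α μ` is a bounded measure. -/
def MemM1 (α : X → ℝ) (μ : Measure X) : Prop :=
  IsProbabilityMeasure μ ∧ IsFiniteMeasure (weight α μ)

/-- The normalized measure `R_α(μ) = (∫ α dμ)⁻¹ α μ`. -/
def renorm (α : X → ℝ) (μ : Measure X) : Measure X :=
  (∫⁻ x, ENNReal.ofReal (α x) ∂μ)⁻¹ • weight α μ

end Weight

section Deformation

variable {X : Type*} [TopologicalSpace X] [T2Space X] [LocallyCompactSpace X]
  [SecondCountableTopology X] [MeasurableSpace X] [BorelSpace X]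

theorem measurable_conv (H : CommHypergroup X) :
    Measurable fun p : X × X => (H.conv p.1 p.2 : Measure X) := by
  have : MetrizableSpace X := metrizableSpace_of_t3_secondCountable X
  refine Measurable.measure_of_isPiSystem_of_isProbabilityMeasure
    (S := {s : Set X | IsClosed s}) ?_ isPiSystem_isClosed ?_
  · rw [BorelSpace.measurable_eq (α := X), borel_eq_generateFrom_isClosed]
  · intro s hs
    have hs' : IsClosed s := hs
    refine measurable_of_tendsto_metrizable (f := fun n (p : X × X) =>
      ∫⁻ x, (hs'.apprSeq n x : ℝ≥0∞) ∂(H.conv p.1 p.2 : Measure X)) ?_ ?_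
    · intro n
      exact (ProbabilityMeasure.continuous_iff_forall_continuous_lintegral.1
        H.continuous_conv (hs'.apprSeq n)).measurable
    · rw [tendsto_pi_nhds]
      intro p
      exact HasOuterApproxClosed.tendsto_lintegral_apprSeq hs' _

theorem IsPositiveSemicharacter.continuous {H : CommHypergroup X} {α : X → ℝ}
    (hα : H.IsPositiveSemicharacter α) : Continuous α := by
  have := Complex.continuous_re.comp hα.isSemicharacter.continuous
  simpa [Function.comp_def] using this

theorem integrable_conv (H : CommHypergroup X) {f : X → ℝ} (hf : Continuous f) (x y : X) :
    Integrable f (H.conv x y : Measure X) := by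
  have h1 : IntegrableOn f (H.conv x y : Measure X).support (H.conv x y : Measure X) :=
    hf.continuousOn.integrableOn_compact (H.isCompact_support x y)
  have h2 : ∀ᵐ z ∂(H.conv x y : Measure X), z ∈ (H.conv x y : Measure X).support :=
    Measure.support_mem_ae
  rwa [IntegrableOn, Measure.restrict_eq_self_of_ae_mem h2] at h1

theorem IsPositiveSemicharacter.integral_conv {H : CommHypergroup X} {α : X → ℝ}
    (hα : H.IsPositiveSemicharacter α) (x y : X) :
    ∫ z, α z ∂(H.conv x y : Measure X) = α x * α y := by
  have h := hα.isSemicharacter.map_conv x y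
  rw [integral_complex_ofReal] at h
  exact_mod_cast h

theorem IsPositiveSemicharacter.lintegral_conv {H : CommHypergroup X} {α : X → ℝ}
    (hα : H.IsPositiveSemicharacter α) (x y : X) :
    ∫⁻ z, ENNReal.ofReal (α z) ∂(H.conv x y : Measure X) =
      ENNReal.ofReal (α x) * ENNReal.ofReal (α y) := by
  rw [← ofReal_integral_eq_lintegral_ofReal (integrable_conv H hα.continuous x y)
    (Eventually.of_forall fun z => (hα.pos z).le), hα.integral_conv,
    ENNReal.ofReal_mul (hα.pos x).le]

theorem IsPositiveSemicharacter.map_inv {H : CommHypergroup X} {α : X → ℝ}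
    (hα : H.IsPositiveSemicharacter α) (x : X) : α (H.inv x) = α x := by
  have h := hα.isSemicharacter.map_inv x
  rw [Complex.conj_ofReal] at h
  exact_mod_cast h

theorem IsPositiveSemicharacter.map_one {H : CommHypergroup X} {α : X → ℝ}
    (hα : H.IsPositiveSemicharacter α) : α H.one = 1 := by
  have h := hα.integral_conv H.one H.one
  rw [H.one_conv, integral_dirac] at h
  have := hα.pos H.one
  nlinarith

/-- The measure `δ_x • δ_y = α₀ ((α₀⁻¹ δ_x) * (α₀⁻¹ δ_y))`. -/
def deformMeasure (H : CommHypergroup X) (α : X → ℝ) (x y : X) : Measure X :=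
  (ENNReal.ofReal (α x) * ENNReal.ofReal (α y))⁻¹ • weight α (H.conv x y : Measure X)

theorem IsPositiveSemicharacter.ofReal_ne {H : CommHypergroup X} {α : X → ℝ}
    (hα : H.IsPositiveSemicharacter α) (x y : X) :
    ENNReal.ofReal (α x) * ENNReal.ofReal (α y) ≠ 0 ∧
      ENNReal.ofReal (α x) * ENNReal.ofReal (α y) ≠ ∞ := by
  have h1 := hα.pos x
  have h2 := hα.pos y
  refine ⟨?_, ENNReal.mul_ne_top ENNReal.ofReal_ne_top ENNReal.ofReal_ne_top⟩
  simp [h1, h2]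

theorem isProbabilityMeasure_deformMeasure {H : CommHypergroup X} {α : X → ℝ}
    (hα : H.IsPositiveSemicharacter α) (x y : X) :
    IsProbabilityMeasure (H.deformMeasure α x y) := by
  constructor
  rw [deformMeasure, Measure.smul_apply, weight, withDensity_apply _ MeasurableSet.univ,
    Measure.restrict_univ, hα.lintegral_conv, smul_eq_mul]
  exact ENNReal.inv_mul_cancel (hα.ofReal_ne x y).1 (hα.ofReal_ne x y).2

/-- The measure `δ_x • δ_y` as a probability measure. -/
def deformConv {H : CommHypergroup X} {α : X → ℝ} (hα : H.IsPositiveSemicharacter α) (x y : X) :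
    ProbabilityMeasure X :=
  ⟨H.deformMeasure α x y, isProbabilityMeasure_deformMeasure hα x y⟩

theorem coe_deformConv {H : CommHypergroup X} {α : X → ℝ} (hα : H.IsPositiveSemicharacter α)
    (x y : X) : (deformConv hα x y : Measure X) = H.deformMeasure α x y := rfl

theorem lintegral_deformMeasure {H : CommHypergroup X} {α : X → ℝ}
    (hα : H.IsPositiveSemicharacter α) (x y : X) {f : X → ℝ≥0∞} (hf : Measurable f) :
    ∫⁻ z, f z ∂(H.deformMeasure α x y) =
      (ENNReal.ofReal (α x) * ENNReal.ofReal (α y))⁻¹ *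
        ∫⁻ z, ENNReal.ofReal (α z) * f z ∂(H.conv x y : Measure X) := by
  have hm : Measurable fun z => ENNReal.ofReal (α z) := hα.continuous.measurable.ennreal_ofReal
  rw [deformMeasure, lintegral_smul_measure, weight, lintegral_withDensity_eq_lintegral_mul _ hm hf]
  rfl

theorem support_deformMeasure {H : CommHypergroup X} {α : X → ℝ}
    (hα : H.IsPositiveSemicharacter α) (x y : X) :
    (H.deformMeasure α x y).support = (H.conv x y : Measure X).support := by
  have hm : Measurable fun z => ENNReal.ofReal (α z) := hα.continuous.measurable.ennreal_ofReal
  apply subset_antisymm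
  · refine Measure.AbsolutelyContinuous.support_mono ?_
    exact (Measure.AbsolutelyContinuous.rfl.smul_left _).trans
      (withDensity_absolutelyContinuous _ _)
  · refine Measure.AbsolutelyContinuous.support_mono ?_
    refine (withDensity_absolutelyContinuous' hm.aemeasurable ?_).trans
      (Measure.absolutelyContinuous_smul (ENNReal.inv_ne_zero.2 (hα.ofReal_ne x y).2))
    exact Eventually.of_forall fun z => by simpa using hα.pos z

theorem continuous_deformMeasure {H : CommHypergroup X} {α : X → ℝ}
    (hα : H.IsPositiveSemicharacter α) :
    Continuous fun p : X × X => deformConv hα p.1 p.2 := by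
  have hαc := hα.continuous
  rw [ProbabilityMeasure.continuous_iff_forall_continuous_integral]
  intro f
  have key : ∀ p : X × X, ∫ z, f z ∂(H.deformMeasure α p.1 p.2) =
      (α p.1 * α p.2)⁻¹ * ∫ z, α z * f z ∂(H.conv p.1 p.2 : Measure X) := by
    intro p
    rw [deformMeasure, integral_smul_measure, weight,
      integral_withDensity_eq_integral_toReal_smul hαc.measurable.ennreal_ofReal
        (Eventually.of_forall fun _ => ENNReal.ofReal_lt_top)]
    simp [ENNReal.toReal_inv, ENNReal.toReal_mul, ENNReal.toReal_ofReal (hα.pos _).le]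
  simp only [coe_deformConv, key]
  refine Continuous.mul (Continuous.inv₀ (by fun_prop)
    fun p => (mul_pos (hα.pos _) (hα.pos _)).ne') ?_
  rw [continuous_iff_continuousAt]
  intro p₀
  obtain ⟨K, hK, hKsub⟩ := exists_compact_superset (H.isCompact_support p₀.1 p₀.2)
  have hnear : ∀ᶠ p in 𝓝 p₀, (H.conv p.1 p.2 : Measure X).support ⊆ interior K :=
    (H.continuous_support.continuousAt (x := p₀)).eventually
      ((Compacts.isOpen_subsets_of_isOpen isOpen_interior).mem_nhds hKsub)
  obtain ⟨C, hC⟩ := hK.exists_bound_of_continuousOn hαc.continuousOn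
  set g : BoundedContinuousFunction X ℝ :=
    BoundedContinuousFunction.ofNormedAddCommGroup (fun z => min (α z) C) (by fun_prop) |C| (by
      intro z
      rw [Real.norm_eq_abs, abs_le]
      constructor
      · exact le_min ((neg_nonpos.2 (abs_nonneg C)).trans (hα.pos z).le) (neg_abs_le C)
      · exact (min_le_right _ _).trans (le_abs_self C)) with hg
  have hcont := ((ProbabilityMeasure.continuous_iff_forall_continuous_integral.1
    H.continuous_conv (g * f)).continuousAt (x := p₀))
  refine hcont.congr ?_
  filter_upwards [hnear] with p hp
  refine integral_congr_ae ?_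
  filter_upwards [Measure.support_mem_ae (μ := (H.conv p.1 p.2 : Measure X))] with z hz
  have hzC : α z ≤ C := (le_abs_self _).trans (hC z (interior_subset (hp hz)))
  simp [hg, hzC]

theorem deformMeasure_apply (H : CommHypergroup X) (α : X → ℝ) (x y : X) {s : Set X} (hs : MeasurableSet s) :
    H.deformMeasure α x y s = (ENNReal.ofReal (α x))⁻¹ * (ENNReal.ofReal (α y))⁻¹ *
      ∫⁻ u, s.indicator (fun u => ENNReal.ofReal (α u)) u ∂(H.conv x y : Measure X) := by
  rw [deformMeasure, Measure.smul_apply, smul_eq_mul, weight, withDensity_apply _ hs,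
    lintegral_indicator hs,
    ENNReal.mul_inv (Or.inr ENNReal.ofReal_ne_top) (Or.inl ENNReal.ofReal_ne_top)]

theorem measurable_deformMeasure {H : CommHypergroup X} {α : X → ℝ}
    (hα : H.IsPositiveSemicharacter α) {f g : X → X} (hf : Measurable f) (hg : Measurable g) :
    Measurable fun w => H.deformMeasure α (f w) (g w) := by
  have hm : Measurable fun z => ENNReal.ofReal (α z) := hα.continuous.measurable.ennreal_ofReal
  have hc : Measurable fun w => (H.conv (f w) (g w) : Measure X) :=
    H.measurable_conv.comp (hf.prodMk hg)
  refine Measure.measurable_of_measurable_coe _ fun s hs => ?_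
  have h3 : Measurable fun w =>
      ∫⁻ u, s.indicator (fun u => ENNReal.ofReal (α u)) u ∂(H.conv (f w) (g w) : Measure X) :=
    (Measure.measurable_lintegral (hm.indicator hs)).comp hc
  simp only [deformMeasure_apply H α _ _ hs]
  exact ((hm.comp hf).inv.mul (hm.comp hg).inv).mul h3

theorem deformMeasure_assoc {H : CommHypergroup X} {α : X → ℝ}
    (hα : H.IsPositiveSemicharacter α) (x y z : X) :
    (H.deformMeasure α x y).bind (fun w => H.deformMeasure α w z) =
      (H.deformMeasure α y z).bind (fun w => H.deformMeasure α x w) := by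
  have hm : Measurable fun z => ENNReal.ofReal (α z) := hα.continuous.measurable.ennreal_ofReal
  have hl : Measurable fun w => H.deformMeasure α w z :=
    measurable_deformMeasure hα measurable_id measurable_const
  have hr : Measurable fun w => H.deformMeasure α x w :=
    measurable_deformMeasure hα measurable_const measurable_id
  have hl' : Measurable fun w => (H.conv w z : Measure X) :=
    H.measurable_conv.comp (measurable_id.prodMk measurable_const)
  have hr' : Measurable fun w => (H.conv x w : Measure X) :=
    H.measurable_conv.comp (measurable_const.prodMk measurable_id)
  have hne : ∀ w, ENNReal.ofReal (α w) ≠ 0 := fun w => by simpa using hα.pos w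
  have hnt : ∀ w, ENNReal.ofReal (α w) ≠ ∞ := fun w => ENNReal.ofReal_ne_top
  ext s hs
  have hval := fun a b => deformMeasure_apply H α a b hs
  have hl'' : Measurable fun w => H.deformMeasure α w z s := (Measure.measurable_coe hs).comp hl
  have hr'' : Measurable fun w => H.deformMeasure α x w s := (Measure.measurable_coe hs).comp hr
  have hS : Measurable (s.indicator fun u => ENNReal.ofReal (α u)) := hm.indicator hs
  rw [Measure.bind_apply hs hl.aemeasurable, Measure.bind_apply hs hr.aemeasurable,
    lintegral_deformMeasure hα _ _ hl'', lintegral_deformMeasure hα _ _ hr'']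
  have hassoc := congrArg
    (fun m => ∫⁻ u, s.indicator (fun u => ENNReal.ofReal (α u)) u ∂m) (H.conv_assoc x y z)
  simp only [Measure.lintegral_bind hl'.aemeasurable hS.aemeasurable,
    Measure.lintegral_bind hr'.aemeasurable hS.aemeasurable] at hassoc
  simp only [hval]
  have hL : Measurable fun w =>
      ∫⁻ u, s.indicator (fun u => ENNReal.ofReal (α u)) u ∂(H.conv w z : Measure X) :=
    (Measure.measurable_lintegral hS).comp hl'
  have hR : Measurable fun w =>
      ∫⁻ u, s.indicator (fun u => ENNReal.ofReal (α u)) u ∂(H.conv x w : Measure X) :=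
    (Measure.measurable_lintegral hS).comp hr'
  revert hassoc hL hR
  clear hl'' hr'' hval
  generalize (s.indicator fun u => ENNReal.ofReal (α u)) = F
  generalize hA : (fun w => ∫⁻ u, F u ∂(H.conv w z : Measure X)) = A'
  generalize hB : (fun w => ∫⁻ u, F u ∂(H.conv x w : Measure X)) = B'
  have eL : ∀ w, ∫⁻ u, F u ∂(H.conv w z : Measure X) = A' w := fun w => congrFun hA w
  have eR : ∀ w, ∫⁻ u, F u ∂(H.conv x w : Measure X) = B' w := fun w => congrFun hB w
  simp only [eL, eR]
  intro hassoc hL hR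
  have e1 : ∀ w, ENNReal.ofReal (α w) *
      ((ENNReal.ofReal (α w))⁻¹ * (ENNReal.ofReal (α z))⁻¹ * A' w) =
      (ENNReal.ofReal (α z))⁻¹ * A' w := by
    intro w
    rw [← mul_assoc, ← mul_assoc, ENNReal.mul_inv_cancel (hne w) (hnt w), one_mul]
  have e2 : ∀ w, ENNReal.ofReal (α w) *
      ((ENNReal.ofReal (α x))⁻¹ * (ENNReal.ofReal (α w))⁻¹ * B' w) =
      (ENNReal.ofReal (α x))⁻¹ * B' w := by
    intro w
    rw [mul_comm (ENNReal.ofReal (α x))⁻¹, ← mul_assoc, ← mul_assoc,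
      ENNReal.mul_inv_cancel (hne w) (hnt w), one_mul]
  simp only [e1, e2]
  rw [lintegral_const_mul _ hL, lintegral_const_mul _ hR, hassoc,
    ENNReal.mul_inv (Or.inl (hne x)) (Or.inl (hnt x)),
    ENNReal.mul_inv (Or.inl (hne y)) (Or.inl (hnt y))]
  rw [mul_comm (ENNReal.ofReal (α x))⁻¹ (ENNReal.ofReal (α y))⁻¹, mul_assoc, mul_assoc,
    mul_left_comm (ENNReal.ofReal (α x))⁻¹]

/-- The deformation `(X, •)` of the commutative hypergroup `(X, *)` with respect to a positive
semicharacter. -/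
def deformation (H : CommHypergroup X) {α : X → ℝ} (hα : H.IsPositiveSemicharacter α) :
    CommHypergroup X where
  conv := deformConv hα
  one := H.one
  inv := H.inv
  continuous_conv := continuous_deformMeasure hα
  isCompact_support x y := by
    rw [coe_deformConv, support_deformMeasure hα]
    exact H.isCompact_support x y
  continuous_support := by
    simp only [coe_deformConv, support_deformMeasure hα]
    exact H.continuous_support
  conv_comm x y := by
    apply Subtype.ext
    change H.deformMeasure α x y = H.deformMeasure α y x
    rw [deformMeasure, deformMeasure, H.conv_comm x y, mul_comm (ENNReal.ofReal (α x))]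
  conv_assoc := deformMeasure_assoc hα
  one_conv x := by
    have hm : Measurable fun z => ENNReal.ofReal (α z) := hα.continuous.measurable.ennreal_ofReal
    ext s hs
    rw [coe_deformConv, deformMeasure, weight, Measure.smul_apply,
      withDensity_apply _ hs, ← lintegral_indicator hs, H.one_conv,
      lintegral_dirac' _ (hm.indicator hs), hα.map_one, Measure.dirac_apply' _ hs]
    by_cases hx : x ∈ s
    · simp [hx, ENNReal.inv_mul_cancel, hα.pos x]
    · simp [hx]
  continuous_inv := H.continuous_inv
  inv_inv := H.inv_inv
  map_inv_conv x y := by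
    have hm : Measurable fun z => ENNReal.ofReal (α z) := hα.continuous.measurable.ennreal_ofReal
    have hi := H.continuous_inv.measurable
    ext s hs
    rw [Measure.map_apply hi hs]
    simp only [coe_deformConv, deformMeasure, weight, Measure.smul_apply, smul_eq_mul,
      withDensity_apply _ hs, withDensity_apply _ (hi hs), hα.map_inv]
    rw [← H.map_inv_conv x y, setLIntegral_map hs hm hi, mul_comm (ENNReal.ofReal (α x))]
    simp only [hα.map_inv]
  one_mem_support_iff x y := by
    rw [coe_deformConv, support_deformMeasure hα]
    exact H.one_mem_support_iff x y

end Deformation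

end CommHypergroup

end

/-! Since `α₀ (δ_x * δ_y) = α₀(x) α₀(y) (δ_x • δ_y)`, multiplication by `α₀` turns `*` into `•` on
measures (`weight_convMeasure`). Hence it carries the `*`-exponential of `tρ` to the `•`-exponential
of `t α₀ρ` (`weight_poisson`). This is an identity of positive measures, valid in `[0, ∞]`, so no
growth condition on `α₀` enters.

If `α₀ρ` has finite mass, it follows that `∫ α₀ dμ_t = exp(t(‖α₀ρ‖ - ‖ρ‖))`, and the renormalized
measures are exactly the Poisson semigroup of `α₀ρ` on the deformation (`renorm_poisson`).
Conversely `μ_t` dominates a positive multiple of `ρ`, the term `n = 1` of its series, so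
integrability of `α₀` for a single `t > 0` already forces `α₀ρ` to be finite. As `α₀` is bounded on
a compact neighborhood of `e` and `ρ` is finite, only the mass of `α₀ρ` away from `e` matters, which
is statement 3.

The semigroup law is the Cauchy product of two exponential series. For bounded continuous `f`, the
integral `∫ f dμ_t` is `e^{-t‖ρ‖}` times a power series in `t` with coefficients at most `‖f‖ ‖ρ‖^n
/ n!`. This gives weak continuity and, when `f(e) = 0`, the derivative `∫ f dρ` at `0`, hence the
Lévy measure. -/

namespace CommHypergroup

/-! ### Exponential series in `[0, ∞]` and in the reals. -/

section Exponential

theorem tsum_inv_factorial_mul_pow (x : ℝ≥0) :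
    ∑' n : ℕ, (n.factorial : ℝ≥0∞)⁻¹ * (x : ℝ≥0∞) ^ n = ENNReal.ofReal (Real.exp x) := by
  rw [Real.exp_eq_exp_ℝ, NormedSpace.exp_eq_tsum_div,
    ENNReal.ofReal_tsum_of_nonneg (fun n => by positivity) (Real.summable_pow_div_factorial _)]
  refine tsum_congr fun n => ?_
  rw [ENNReal.ofReal_div_of_pos (by positivity), ENNReal.ofReal_natCast, ← NNReal.coe_pow,
    ENNReal.ofReal_coe_nnreal, div_eq_mul_inv, mul_comm, ENNReal.coe_pow]

/-- Group the terms by `k = m + n` and apply the binomial theorem; in `[0, ∞]` the rearrangement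
needs no convergence. It is used with `c k` the integral against the `k`-th convolution power, which
may be infinite. -/
theorem tsum_tsum_inv_factorial_mul_pow (s t : ℝ≥0∞) (c : ℕ → ℝ≥0∞) :
    ∑' m : ℕ, ∑' n : ℕ, (m.factorial : ℝ≥0∞)⁻¹ * s ^ m *
        ((n.factorial : ℝ≥0∞)⁻¹ * t ^ n * c (m + n)) =
      ∑' k : ℕ, (k.factorial : ℝ≥0∞)⁻¹ * (s + t) ^ k * c k := by
  rw [← ENNReal.tsum_prod (f := fun m n : ℕ => (m.factorial : ℝ≥0∞)⁻¹ * s ^ m *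
    ((n.factorial : ℝ≥0∞)⁻¹ * t ^ n * c (m + n))),
    ← (Finset.HasAntidiagonal.sigmaAntidiagonalEquivProd (A := ℕ)).tsum_eq, ENNReal.tsum_sigma']
  refine tsum_congr fun k => ?_
  rw [tsum_fintype, Finset.univ_eq_attach, (Commute.all s t).add_pow',
    Finset.mul_sum, Finset.sum_mul, ← Finset.sum_attach (Finset.HasAntidiagonal.antidiagonal k)]
  refine Finset.sum_congr rfl fun p _ => ?_
  obtain ⟨⟨m, n⟩, hp⟩ := p
  have hp' : m + n = k := Finset.HasAntidiagonal.mem_antidiagonal.1 hp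
  subst hp'
  change (m.factorial : ℝ≥0∞)⁻¹ * s ^ m * ((n.factorial : ℝ≥0∞)⁻¹ * t ^ n * c (m + n)) =
    ((m + n).factorial : ℝ≥0∞)⁻¹ * ((m + n).choose m • (s ^ m * t ^ n)) * c (m + n)
  have h : (m.factorial : ℝ≥0∞)⁻¹ * (n.factorial : ℝ≥0∞)⁻¹ =
      ((m + n).factorial : ℝ≥0∞)⁻¹ * ((m + n).choose m : ℝ≥0∞) := by
    have hc : (((m + n).choose m : ℕ) : ℝ≥0∞) ≠ 0 :=
      Nat.cast_ne_zero.2 (Nat.choose_pos (Nat.le_add_right m n)).ne'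
    rw [← Nat.choose_mul_factorial_mul_factorial (Nat.le_add_right m n), Nat.add_sub_cancel_left,
      mul_assoc, Nat.cast_mul,
      ENNReal.mul_inv (Or.inl hc) (Or.inl (ENNReal.natCast_ne_top _)), mul_right_comm,
      ENNReal.inv_mul_cancel hc (ENNReal.natCast_ne_top _), one_mul, Nat.cast_mul,
      ENNReal.mul_inv (Or.inr (ENNReal.natCast_ne_top _)) (Or.inl (ENNReal.natCast_ne_top _))]
  calc _ = (m.factorial : ℝ≥0∞)⁻¹ * (n.factorial : ℝ≥0∞)⁻¹ * (s ^ m * t ^ n) * c (m + n) := by ring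
    _ = _ := by rw [h, nsmul_eq_mul]; ring

theorem summable_pow_mul {c : ℕ → ℝ} {C M : ℝ} (hc : ∀ n, |c n| ≤ C * M ^ n / n.factorial) (t : ℝ≥0) :
    Summable fun n : ℕ => (t : ℝ) ^ n * c n := by
  refine Summable.of_norm_bounded
    ((Real.summable_pow_div_factorial ((t : ℝ) * M)).mul_left C) fun n => ?_
  rw [Real.norm_eq_abs, abs_mul, abs_of_nonneg (by positivity : (0 : ℝ) ≤ (t : ℝ) ^ n)]
  calc (t : ℝ) ^ n * |c n| ≤ (t : ℝ) ^ n * (C * M ^ n / n.factorial) := by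
        gcongr
        exact hc n
    _ = C * (((t : ℝ) * M) ^ n / n.factorial) := by rw [mul_pow]; ring

theorem continuous_tsum_pow_mul {c : ℕ → ℝ} {C M : ℝ} (hc : ∀ n, |c n| ≤ C * M ^ n / n.factorial) :
    Continuous fun t : ℝ≥0 => ∑' n : ℕ, (t : ℝ) ^ n * c n := by
  rw [continuous_iff_continuousAt]
  intro t₀
  -- The Weierstrass majorant must not depend on `t`, so `t` is confined to a bounded neighborhood
  -- of `t₀`.
  have h : ContinuousOn (fun t : ℝ≥0 => ∑' n : ℕ, (t : ℝ) ^ n * c n) (Set.Iio (t₀ + 1)) := by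
    refine continuousOn_tsum (f := fun (n : ℕ) (t : ℝ≥0) => (t : ℝ) ^ n * c n) (u := fun n => C * ((((t₀ : ℝ) + 1) * M) ^ n / n.factorial))
      (fun n => ((NNReal.continuous_coe.pow n).mul continuous_const).continuousOn)
      ((Real.summable_pow_div_factorial _).mul_left C) ?_
    intro n t ht
    have ht' : (t : ℝ) ≤ t₀ + 1 := by exact_mod_cast (Set.mem_Iio.1 ht).le
    rw [Real.norm_eq_abs, abs_mul, abs_of_nonneg (by positivity : (0 : ℝ) ≤ (t : ℝ) ^ n)]
    calc (t : ℝ) ^ n * |c n| ≤ ((t₀ : ℝ) + 1) ^ n * (C * M ^ n / n.factorial) := by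
          gcongr
          exact hc n
      _ = C * ((((t₀ : ℝ) + 1) * M) ^ n / n.factorial) := by rw [mul_pow]; ring
  exact h.continuousAt (Iio_mem_nhds (by simp))

end Exponential

/-! ### Convolution of measures, convolution powers and exponentials. -/

section Convolution

variable {X : Type*} [TopologicalSpace X] [T2Space X] [LocallyCompactSpace X]
  [SecondCountableTopology X] [MeasurableSpace X] [BorelSpace X] (H : CommHypergroup X)

theorem measurable_lintegral_conv {f : X → ℝ≥0∞} (hf : Measurable f) :
    Measurable fun p : X × X => ∫⁻ z, f z ∂(H.conv p.1 p.2 : Measure X) :=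
  (Measure.measurable_lintegral hf).comp H.measurable_conv

theorem measurable_lintegral_conv_right {f : X → ℝ≥0∞} (hf : Measurable f) (x : X) :
    Measurable fun y => ∫⁻ z, f z ∂(H.conv x y : Measure X) :=
  (H.measurable_lintegral_conv hf).comp measurable_prodMk_left

theorem lintegral_convMeasure (μ ν : Measure X) [SFinite ν] {f : X → ℝ≥0∞} (hf : Measurable f) :
    ∫⁻ z, f z ∂(H.convMeasure μ ν) =
      ∫⁻ x, ∫⁻ y, ∫⁻ z, f z ∂(H.conv x y : Measure X) ∂ν ∂μ := by
  rw [convMeasure, Measure.lintegral_bind H.measurable_conv.aemeasurable hf.aemeasurable,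
    lintegral_prod _ (H.measurable_lintegral_conv hf).aemeasurable]

theorem convMeasure_univ (μ ν : Measure X) [SFinite ν] :
    H.convMeasure μ ν Set.univ = μ Set.univ * ν Set.univ := by
  have h := H.lintegral_convMeasure μ ν (f := fun _ => 1) measurable_const
  simpa [mul_comm] using h

instance isFiniteMeasure_convMeasure (μ ν : Measure X) [IsFiniteMeasure μ] [IsFiniteMeasure ν] :
    IsFiniteMeasure (H.convMeasure μ ν) :=
  ⟨by rw [convMeasure_univ]; exact ENNReal.mul_lt_top (measure_lt_top _ _) (measure_lt_top _ _)⟩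

instance isFiniteMeasure_convPow (μ : Measure X) [IsFiniteMeasure μ] (n : ℕ) :
    IsFiniteMeasure (H.convPow μ n) := by
  induction n with
  | zero => exact inferInstanceAs (IsFiniteMeasure (Measure.dirac H.one))
  | succ n ih => exact inferInstanceAs (IsFiniteMeasure (H.convMeasure (H.convPow μ n) μ))

theorem convMeasure_dirac_one (μ : Measure X) : H.convMeasure μ (Measure.dirac H.one) = μ := by
  refine Measure.ext_of_lintegral _ fun f hf => ?_
  rw [H.lintegral_convMeasure _ _ hf]
  refine lintegral_congr fun x => ?_
  rw [lintegral_dirac' _ (H.measurable_lintegral_conv_right hf x), H.conv_comm, H.one_conv, lintegral_dirac' _ hf]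

theorem dirac_one_convMeasure (μ : Measure X) [SFinite μ] :
    H.convMeasure (Measure.dirac H.one) μ = μ := by
  refine Measure.ext_of_lintegral _ fun f hf => ?_
  rw [H.lintegral_convMeasure _ _ hf,
    lintegral_dirac' _ (H.measurable_lintegral_conv hf).lintegral_prod_right']
  refine lintegral_congr fun x => ?_
  rw [H.one_conv, lintegral_dirac' _ hf]

theorem convMeasure_assoc (μ ν σ : Measure X) [SFinite ν] [SFinite σ]
    [SFinite (H.convMeasure ν σ)] :
    H.convMeasure (H.convMeasure μ ν) σ = H.convMeasure μ (H.convMeasure ν σ) := by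
  refine Measure.ext_of_lintegral _ fun f hf => ?_
  have hF := H.measurable_lintegral_conv hf
  rw [H.lintegral_convMeasure _ _ hf, H.lintegral_convMeasure _ _ hf,
    H.lintegral_convMeasure _ _ hF.lintegral_prod_right']
  refine lintegral_congr fun x => ?_
  rw [H.lintegral_convMeasure _ _ (H.measurable_lintegral_conv_right hf x)]
  refine lintegral_congr fun y => ?_
  -- After Tonelli has brought the `σ`-integral outside, associativity on point masses applies for
  -- fixed `x`, `y`, `z`.
  rw [lintegral_lintegral_swap hF.aemeasurable]
  refine lintegral_congr fun z => ?_
  have h := congrArg (fun m => ∫⁻ u, f u ∂m) (H.conv_assoc x y z)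
  have hl : Measurable fun w => (H.conv w z : Measure X) :=
    H.measurable_conv.comp measurable_prodMk_right
  have hr : Measurable fun w => (H.conv x w : Measure X) :=
    H.measurable_conv.comp measurable_prodMk_left
  rwa [Measure.lintegral_bind hl.aemeasurable hf.aemeasurable,
    Measure.lintegral_bind hr.aemeasurable hf.aemeasurable] at h

theorem smul_convMeasure_smul (a b : ℝ≥0) (μ ν : Measure X) [SFinite ν] :
    H.convMeasure (a • μ) (b • ν) = (a * b) • H.convMeasure μ ν := by
  refine Measure.ext_of_lintegral _ fun f hf => ?_
  simp only [H.lintegral_convMeasure _ _ hf, lintegral_smul_measure, ENNReal.smul_def, smul_eq_mul]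
  rw [lintegral_const_mul _ (H.measurable_lintegral_conv hf).lintegral_prod_right',
    ENNReal.coe_mul, mul_assoc]

variable (ρ : Measure X) [IsFiniteMeasure ρ]

theorem convPow_add (m n : ℕ) :
    H.convPow ρ (m + n) = H.convMeasure (H.convPow ρ m) (H.convPow ρ n) := by
  induction n with
  | zero => exact (H.convMeasure_dirac_one _).symm
  | succ n ih =>
    rw [← add_assoc, convPow, ih, convMeasure_assoc]
    rfl

theorem convPow_univ (n : ℕ) : H.convPow ρ n Set.univ = ρ Set.univ ^ n := by
  induction n with
  | zero => simp [convPow]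
  | succ n ih => rw [convPow, convMeasure_univ, ih, pow_succ]

theorem convPow_smul (a : ℝ≥0) (n : ℕ) : H.convPow (a • ρ) n = a ^ n • H.convPow ρ n := by
  induction n with
  | zero => simp [convPow]
  | succ n ih => rw [convPow, ih, smul_convMeasure_smul, convPow, pow_succ]

theorem convPow_one : H.convPow ρ 1 = ρ := H.dirac_one_convMeasure ρ

theorem lintegral_expMeasure (t : ℝ≥0) (f : X → ℝ≥0∞) :
    ∫⁻ x, f x ∂(H.expMeasure (t • ρ)) =
      ∑' n : ℕ, (n.factorial : ℝ≥0∞)⁻¹ * (t : ℝ≥0∞) ^ n * ∫⁻ x, f x ∂(H.convPow ρ n) := by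
  rw [expMeasure, lintegral_sum_measure]
  refine tsum_congr fun n => ?_
  rw [convPow_smul, lintegral_smul_measure, lintegral_smul_measure, smul_eq_mul, ENNReal.smul_def,
    smul_eq_mul, ENNReal.coe_pow, mul_assoc]

theorem expMeasure_univ : H.expMeasure ρ Set.univ = ENNReal.ofReal (Real.exp (ρ.real Set.univ)) := by
  have h := H.lintegral_expMeasure ρ 1 (fun _ => 1)
  simp only [lintegral_const, one_mul, one_smul, ENNReal.coe_one, one_pow, mul_one,
    convPow_univ] at h
  rw [h, measureReal_def, ← ENNReal.coe_toNNReal (measure_ne_top ρ Set.univ),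
    tsum_inv_factorial_mul_pow, ENNReal.coe_toReal]

instance isFiniteMeasure_expMeasure : IsFiniteMeasure (H.expMeasure ρ) :=
  ⟨by rw [expMeasure_univ]; exact ENNReal.ofReal_lt_top⟩

/-- Tested against a nonnegative function, both sides become double series, matched by `convPow_add`
and the Cauchy product. -/
theorem expMeasure_add_smul (s t : ℝ≥0) :
    H.expMeasure ((s + t) • ρ) = H.convMeasure (H.expMeasure (s • ρ)) (H.expMeasure (t • ρ)) := by
  refine Measure.ext_of_lintegral _ fun f hf => ?_
  have hF := H.measurable_lintegral_conv hf
  rw [H.lintegral_convMeasure _ _ hf]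
  simp only [lintegral_expMeasure]
  rw [ENNReal.coe_add, ← tsum_tsum_inv_factorial_mul_pow]
  refine tsum_congr fun m => ?_
  rw [lintegral_tsum fun n => (hF.lintegral_prod_right'.const_mul _).aemeasurable,
    ← ENNReal.tsum_mul_left]
  refine tsum_congr fun n => ?_
  rw [lintegral_const_mul _ hF.lintegral_prod_right', H.convPow_add, H.lintegral_convMeasure _ _ hf]

/-! ### The Poisson semigroup and its derivative at zero. -/

theorem lintegral_poisson (t : ℝ≥0) (f : X → ℝ≥0∞) :
    ∫⁻ x, f x ∂(H.poisson ρ t) = ENNReal.ofReal (Real.exp (-((t : ℝ) * ρ.real Set.univ))) *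
      ∑' n : ℕ, (n.factorial : ℝ≥0∞)⁻¹ * (t : ℝ≥0∞) ^ n * ∫⁻ x, f x ∂(H.convPow ρ n) := by
  rw [poisson, lintegral_smul_measure, lintegral_expMeasure, smul_eq_mul]

theorem isProbabilityMeasure_poisson (t : ℝ≥0) : IsProbabilityMeasure (H.poisson ρ t) := by
  constructor
  rw [poisson, Measure.smul_apply, expMeasure_univ, smul_eq_mul,
    ← ENNReal.ofReal_mul (Real.exp_nonneg _), ← Real.exp_add]
  rw [measureReal_nnreal_smul_apply, neg_add_cancel, Real.exp_zero, ENNReal.ofReal_one]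

theorem poisson_zero : H.poisson ρ 0 = Measure.dirac H.one := by
  refine Measure.ext_of_lintegral _ fun f hf => ?_
  rw [lintegral_poisson, tsum_eq_single 0 (fun n hn => by simp [hn])]
  simp [convPow]

theorem poisson_add (s t : ℝ≥0) :
    H.poisson ρ (s + t) = H.convMeasure (H.poisson ρ s) (H.poisson ρ t) := by
  -- `ENNReal.ofReal` is by definition the coercion of `Real.toNNReal`, so these scalars agree
  -- definitionally with those in `poisson`.
  have h := H.smul_convMeasure_smul (Real.exp (-((s : ℝ) * ρ.real Set.univ))).toNNReal
    (Real.exp (-((t : ℝ) * ρ.real Set.univ))).toNNReal (H.expMeasure (s • ρ)) (H.expMeasure (t • ρ))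
  rw [← expMeasure_add_smul, ← Real.toNNReal_mul (Real.exp_nonneg _), ← Real.exp_add] at h
  have e : -(((s + t : ℝ≥0) : ℝ) * ρ.real Set.univ) =
      -((s : ℝ) * ρ.real Set.univ) + -((t : ℝ) * ρ.real Set.univ) := by push_cast; ring
  rw [poisson, e]
  exact h.symm

theorem abs_integral_convPow_le {f : X → ℝ} {C : ℝ} (hC : ∀ x, |f x| ≤ C) (n : ℕ) :
    |∫ x, f x ∂(H.convPow ρ n)| ≤ C * ρ.real Set.univ ^ n := by
  have h := norm_integral_le_of_norm_le_const (μ := H.convPow ρ n) (f := f)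
    (Eventually.of_forall hC)
  simpa [measureReal_def, convPow_univ] using h

theorem integral_poisson (t : ℝ≥0) (f : BoundedContinuousFunction X ℝ) :
    ∫ x, f x ∂(H.poisson ρ t) = Real.exp (-((t : ℝ) * ρ.real Set.univ)) *
      ∑' n : ℕ, (t : ℝ) ^ n * ((n.factorial : ℝ)⁻¹ * ∫ x, f x ∂(H.convPow ρ n)) := by
  have hint : Integrable f (H.expMeasure (t • ρ)) := f.integrable _
  rw [poisson, integral_smul_measure, ENNReal.toReal_ofReal (Real.exp_nonneg _), smul_eq_mul,
    expMeasure, ← (hasSum_integral_measure hint).tsum_eq]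
  congr 1
  refine tsum_congr fun n => ?_
  rw [integral_smul_measure, convPow_smul, integral_smul_nnreal_measure]
  simp only [ENNReal.toReal_inv, ENNReal.toReal_natCast, smul_eq_mul, NNReal.smul_def,
    NNReal.coe_pow]
  ring

theorem abs_coeff_integral_poisson_le (f : BoundedContinuousFunction X ℝ) (n : ℕ) :
    |(n.factorial : ℝ)⁻¹ * ∫ x, f x ∂(H.convPow ρ n)| ≤
      ‖f‖ * ρ.real Set.univ ^ n / n.factorial := by
  rw [abs_mul, abs_of_nonneg (by positivity), mul_comm, ← div_eq_mul_inv]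
  gcongr
  exact H.abs_integral_convPow_le ρ f.norm_coe_le_norm n

theorem isConvolutionSemigroup_poisson : H.IsConvolutionSemigroup (H.poisson ρ) where
  isProbabilityMeasure := H.isProbabilityMeasure_poisson ρ
  zero := H.poisson_zero ρ
  add := H.poisson_add ρ
  continuous f := by
    simp only [integral_poisson]
    exact Continuous.mul (by fun_prop)
      (continuous_tsum_pow_mul (H.abs_coeff_integral_poisson_le ρ f))

/-- The constant term of the power series is `f(e) = 0`; dividing by `t` shifts the series, and the
shifted series is continuous with value `∫ f dρ` at `0`. -/
theorem tendsto_inv_mul_integral_poisson (f : BoundedContinuousFunction X ℝ) (hf : f H.one = 0) :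
    Tendsto (fun t : ℝ≥0 => (t : ℝ)⁻¹ * ∫ x, f x ∂(H.poisson ρ t)) (𝓝[>] 0)
      (𝓝 (∫ x, f x ∂ρ)) := by
  set c : ℕ → ℝ := fun n => (n.factorial : ℝ)⁻¹ * ∫ x, f x ∂(H.convPow ρ n) with hc
  have hc0 : c 0 = 0 := by simp [hc, convPow, hf]
  have hc1 : c 1 = ∫ x, f x ∂ρ := by simp [hc, convPow_one]
  have hb : ∀ n, |c n| ≤ ‖f‖ * ρ.real Set.univ ^ n / n.factorial :=
    H.abs_coeff_integral_poisson_le ρ f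
  -- The extra factor `‖ρ‖` goes into the constant, and `n! ≤ (n + 1)!` restores the shape required
  -- by `continuous_tsum_pow_mul`.
  have hb' : ∀ n, |c (n + 1)| ≤ (‖f‖ * ρ.real Set.univ) * ρ.real Set.univ ^ n / n.factorial := by
    intro n
    refine (hb (n + 1)).trans ?_
    rw [pow_succ', ← mul_assoc]
    gcongr
    exact Nat.le_succ n
  have hcont : Continuous fun t : ℝ≥0 => Real.exp (-((t : ℝ) * ρ.real Set.univ)) *
      ∑' n : ℕ, (t : ℝ) ^ n * c (n + 1) :=
    Continuous.mul (by fun_prop) (continuous_tsum_pow_mul hb')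
  have hlim := (hcont.tendsto 0).mono_left (nhdsWithin_le_nhds (s := Set.Ioi 0))
  have hval : Real.exp (-(((0 : ℝ≥0) : ℝ) * ρ.real Set.univ)) *
      ∑' n : ℕ, ((0 : ℝ≥0) : ℝ) ^ n * c (n + 1) = ∫ x, f x ∂ρ := by
    rw [tsum_eq_single 0 (fun n hn => by simp [hn])]
    simp [hc1]
  rw [hval] at hlim
  refine hlim.congr' ?_
  filter_upwards [self_mem_nhdsWithin] with t ht
  have ht' : (t : ℝ) ≠ 0 := by exact_mod_cast (Set.mem_Ioi.1 ht).ne'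
  rw [integral_poisson, (summable_pow_mul hb t).tsum_eq_zero_add, hc0, mul_zero, zero_add]
  simp only [pow_succ', mul_assoc, tsum_mul_left]
  field_simp

end Convolution

end CommHypergroup
namespace CommHypergroup

/-! ### Existence and uniqueness of the Lévy measure. -/

section Levy

variable {X : Type*} [TopologicalSpace X] [T2Space X] [LocallyCompactSpace X]
  [SecondCountableTopology X] [MeasurableSpace X] [BorelSpace X] (H : CommHypergroup X)

theorem isLevyMeasure_poisson (ρ : Measure X) [IsFiniteMeasure ρ] :
    H.IsLevyMeasure (H.poisson ρ) (ρ.restrict {H.one}ᶜ) where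
  apply_one := by simp
  apply_lt_top K _ _ := measure_lt_top _ K
  tendsto f hf hfc hf1 := by
    obtain ⟨C, hC⟩ := hfc.exists_bound_of_continuous hf
    have hf0 : f H.one = 0 := image_eq_zero_of_notMem_tsupport hf1
    have h : ∫ x, f x ∂(ρ.restrict {H.one}ᶜ) = ∫ x, f x ∂ρ :=
      setIntegral_eq_integral_of_forall_compl_eq_zero fun x hx => by
        rw [Set.notMem_compl_iff, Set.mem_singleton_iff] at hx
        rw [hx, hf0]
    rw [h]
    exact H.tendsto_inv_mul_integral_poisson ρ
      (BoundedContinuousFunction.ofNormedAddCommGroup f hf C hC) hf0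

/-- Multiply both measures by a cutoff `g` equal to `1` on `K` and supported in a compact `L ⊆ U`.
The products are finite and agree on every bounded continuous `f`, because `g f` is an admissible
test function; on `K` the cutoff is invisible. -/
theorem restrict_eq_of_forall_integral_eq {η η' : Measure X} {U K : Set X} (hU : IsOpen U)
    (hη : ∀ K, IsCompact K → K ⊆ U → η K < ∞) (hη' : ∀ K, IsCompact K → K ⊆ U → η' K < ∞)
    (h : ∀ f : X → ℝ, Continuous f → HasCompactSupport f → tsupport f ⊆ U →
      ∫ x, f x ∂η = ∫ x, f x ∂η') (hK : IsCompact K) (hKU : K ⊆ U) :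
    η.restrict K = η'.restrict K := by
  have : MetrizableSpace X := metrizableSpace_of_t3_secondCountable X
  obtain ⟨L, hL, hLc, hKL, hLU⟩ := exists_compact_closed_between hK hU hKU
  obtain ⟨g, hg1, hg0, hgc, hg⟩ := exists_continuous_one_zero_of_isCompact hK
    (isOpen_interior (s := L)).isClosed_compl (Set.disjoint_compl_right_iff_subset.2 hKL)
  have hgL : tsupport g ⊆ L := closure_minimal (fun x hx => by
    by_contra hxL
    exact hx (hg0 fun hx' => hxL (interior_subset hx'))) hLc
  have hm : Measurable fun x => ENNReal.ofReal (g x) := g.continuous.measurable.ennreal_ofReal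
  have hfin : ∀ ν : Measure X, ν L < ∞ → IsFiniteMeasure (weight g ν) := by
    intro ν hν
    constructor
    rw [weight, withDensity_apply _ MeasurableSet.univ, Measure.restrict_univ]
    calc ∫⁻ x, ENNReal.ofReal (g x) ∂ν ≤ ∫⁻ x, L.indicator 1 x ∂ν := by
          refine lintegral_mono fun x => ?_
          by_cases hx : x ∈ L
          · simpa [hx] using (hg x).2
          · simp [image_eq_zero_of_notMem_tsupport fun hx' => hx (hgL hx'), hx]
      _ = ν L := lintegral_indicator_one hLc.measurableSet
      _ < ∞ := hν
  have := hfin η (hη L hL hLU)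
  have := hfin η' (hη' L hL hLU)
  have key : weight g η = weight g η' := by
    refine ext_of_forall_integral_eq_of_IsFiniteMeasure fun f => ?_
    rw [weight, weight, integral_withDensity_eq_integral_toReal_smul hm
      (Eventually.of_forall fun _ => ENNReal.ofReal_lt_top),
      integral_withDensity_eq_integral_toReal_smul hm
      (Eventually.of_forall fun _ => ENNReal.ofReal_lt_top)]
    simp only [ENNReal.toReal_ofReal (hg _).1, smul_eq_mul]
    exact h (fun x => g x * f x) (by fun_prop) hgc.mul_right
      ((tsupport_mul_subset_left).trans (hgL.trans hLU))
  have hrestr : ∀ ν : Measure X, (weight g ν).restrict K = ν.restrict K := by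
    intro ν
    rw [weight, restrict_withDensity hK.measurableSet]
    conv_rhs => rw [← withDensity_one (μ := ν.restrict K)]
    refine withDensity_congr_ae ?_
    filter_upwards [ae_restrict_mem hK.measurableSet] with x hx
    simp [hg1 hx]
  rw [← hrestr η, key, hrestr]

theorem IsLevyMeasure.unique {μ : ℝ≥0 → Measure X} {η η' : Measure X}
    (hη : H.IsLevyMeasure μ η) (hη' : H.IsLevyMeasure μ η') : η = η' := by
  have : MetrizableSpace X := metrizableSpace_of_t3_secondCountable X
  have hU : IsOpen ({H.one}ᶜ : Set X) := isOpen_compl_singleton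
  have hint : ∀ f : X → ℝ, Continuous f → HasCompactSupport f → tsupport f ⊆ {H.one}ᶜ →
      ∫ x, f x ∂η = ∫ x, f x ∂η' := fun f hf hfc hfU =>
    tendsto_nhds_unique (hη.tendsto f hf hfc fun h => hfU h rfl)
      (hη'.tendsto f hf hfc fun h => hfU h rfl)
  have hcompact : ∀ K, IsCompact K → K ⊆ {H.one}ᶜ → η.restrict K = η'.restrict K :=
    fun K => restrict_eq_of_forall_integral_eq hU
      (fun K hK hKU => hη.apply_lt_top K hK fun h => hKU h rfl)
      (fun K hK hKU => hη'.apply_lt_top K hK fun h => hKU h rfl) hint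
  let _ := metrizableSpaceMetric X
  obtain ⟨F, hFc, hFU, hF, -⟩ := hU.exists_iUnion_isClosed
  -- The open set `X \ {e}` is a countable union of closed sets; cutting these with a compact
  -- covering of `X` makes the pieces compact.
  have hF' : ⋃ p : ℕ × ℕ, F p.1 ∩ compactCovering X p.2 = {H.one}ᶜ := by
    rw [Set.iUnion_prod', ← hF]
    simp [← Set.inter_iUnion, iUnion_compactCovering]
  have h : η.restrict {H.one}ᶜ = η'.restrict {H.one}ᶜ := by
    rw [← hF', Measure.restrict_iUnion_congr]
    exact fun p => hcompact _ ((isCompact_compactCovering X p.2).inter_left (hFc p.1))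
      (Set.inter_subset_left.trans (hFU p.1))
  have hself : ∀ ν : Measure X, ν {H.one} = 0 → ν.restrict {H.one}ᶜ = ν := fun ν hν =>
    Measure.restrict_eq_self_of_ae_mem (compl_mem_ae_iff.2 hν)
  rw [← hself η hη.apply_one, h, hself η' hη'.apply_one]

theorem isLevyMeasure_poisson_iff (ρ : Measure X) [IsFiniteMeasure ρ] (η : Measure X) :
    H.IsLevyMeasure (H.poisson ρ) η ↔ η = ρ.restrict {H.one}ᶜ :=
  ⟨fun h => h.unique H (H.isLevyMeasure_poisson ρ), fun h => h ▸ H.isLevyMeasure_poisson ρ⟩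

end Levy

/-! ### Weighted measures and the passage to the deformation. -/

section Weight

variable {X : Type*} [MeasurableSpace X]

theorem weight_univ (α : X → ℝ) (μ : Measure X) :
    weight α μ Set.univ = ∫⁻ x, ENNReal.ofReal (α x) ∂μ := by
  rw [weight, withDensity_apply _ MeasurableSet.univ, Measure.restrict_univ]

theorem lintegral_weight {α : X → ℝ} (hα : Measurable α) (μ : Measure X) {f : X → ℝ≥0∞}
    (hf : Measurable f) : ∫⁻ x, f x ∂(weight α μ) = ∫⁻ x, ENNReal.ofReal (α x) * f x ∂μ :=
  lintegral_withDensity_eq_lintegral_mul _ hα.ennreal_ofReal hf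

instance sFinite_weight (α : X → ℝ) (μ : Measure X) [SFinite μ] : SFinite (weight α μ) :=
  inferInstanceAs (SFinite (μ.withDensity _))

end Weight

section Deformation

variable {X : Type*} [TopologicalSpace X] [T2Space X] [LocallyCompactSpace X]
  [SecondCountableTopology X] [MeasurableSpace X] [BorelSpace X] {H : CommHypergroup X} {α : X → ℝ}

/-- The weights are multiplied out to avoid inverses in `[0, ∞]`, and nested so that each one joins
its own integral in `weight_convMeasure`. -/
theorem lintegral_deformation_conv (hα : H.IsPositiveSemicharacter α) (x y : X) {f : X → ℝ≥0∞}
    (hf : Measurable f) :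
    ENNReal.ofReal (α x) * (ENNReal.ofReal (α y) *
        ∫⁻ z, f z ∂((H.deformation hα).conv x y : Measure X)) =
      ∫⁻ z, ENNReal.ofReal (α z) * f z ∂(H.conv x y : Measure X) := by
  rw [← mul_assoc]
  refine (congrArg _ (lintegral_deformMeasure hα x y hf)).trans ?_
  rw [← mul_assoc, ENNReal.mul_inv_cancel (hα.ofReal_ne x y).1 (hα.ofReal_ne x y).2, one_mul]

theorem weight_convMeasure (hα : H.IsPositiveSemicharacter α) (μ ν : Measure X) [SFinite ν] :
    weight α (H.convMeasure μ ν) =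
      (H.deformation hα).convMeasure (weight α μ) (weight α ν) := by
  have hm : Measurable fun z => ENNReal.ofReal (α z) := hα.continuous.measurable.ennreal_ofReal
  refine Measure.ext_of_lintegral _ fun f hf => ?_
  have hg : Measurable fun z => ENNReal.ofReal (α z) * f z := hm.mul hf
  have hF := (H.deformation hα).measurable_lintegral_conv hf
  have hx : ∀ x, Measurable fun y => ∫⁻ z, f z ∂((H.deformation hα).conv x y : Measure X) :=
    fun x => (H.deformation hα).measurable_lintegral_conv_right hf x
  have hy : ∀ x, Measurable fun y => ENNReal.ofReal (α y) *
      ∫⁻ z, f z ∂((H.deformation hα).conv x y : Measure X) := fun x => hm.mul (hx x)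
  rw [lintegral_weight hα.continuous.measurable _ hf, H.lintegral_convMeasure _ _ hg,
    (H.deformation hα).lintegral_convMeasure _ _ hf,
    lintegral_weight hα.continuous.measurable _ hF.lintegral_prod_right']
  refine lintegral_congr fun x => ?_
  rw [lintegral_weight hα.continuous.measurable _ (hx x), ← lintegral_const_mul _ (hy x)]
  exact lintegral_congr fun y => (lintegral_deformation_conv hα x y hf).symm

theorem weight_dirac_one (hα : H.IsPositiveSemicharacter α) :
    weight α (Measure.dirac H.one) = Measure.dirac H.one := by
  refine Measure.ext_of_lintegral _ fun f hf => ?_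
  have hg : Measurable fun z => ENNReal.ofReal (α z) * f z :=
    hα.continuous.measurable.ennreal_ofReal.mul hf
  rw [lintegral_weight hα.continuous.measurable _ hf, lintegral_dirac' _ hf,
    lintegral_dirac' _ hg, hα.map_one, ENNReal.ofReal_one, one_mul]

theorem weight_convPow (hα : H.IsPositiveSemicharacter α) (ρ : Measure X) [SFinite ρ] (n : ℕ) :
    weight α (H.convPow ρ n) = (H.deformation hα).convPow (weight α ρ) n := by
  induction n with
  | zero => exact weight_dirac_one hα
  | succ n ih => rw [convPow, weight_convMeasure hα, ih, convPow]

/-- `α ρ` may have infinite mass here. The scalar still involves `‖ρ‖` rather than `‖α ρ‖`, so the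
right side is not yet normalized. -/
theorem weight_poisson (hα : H.IsPositiveSemicharacter α) (ρ : Measure X) [SFinite ρ] (t : ℝ≥0) :
    weight α (H.poisson ρ t) = ENNReal.ofReal (Real.exp (-((t : ℝ) * ρ.real Set.univ))) •
      (H.deformation hα).expMeasure (t • weight α ρ) := by
  have h : t • weight α ρ = weight α (t • ρ) :=
    (withDensity_smul_measure (t : ℝ≥0∞) _).symm
  rw [weight, poisson, withDensity_smul_measure, h]
  congr 1
  simp only [expMeasure, withDensity_sum, withDensity_smul_measure, ← weight_convPow hα]
  rfl


theorem weight_poisson_univ (hα : H.IsPositiveSemicharacter α) (ρ : Measure X) [IsFiniteMeasure ρ]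
    [IsFiniteMeasure (weight α ρ)] (t : ℝ≥0) :
    weight α (H.poisson ρ t) Set.univ =
      ENNReal.ofReal (Real.exp ((t : ℝ) * ((weight α ρ).real Set.univ - ρ.real Set.univ))) := by
  rw [weight_poisson hα, Measure.smul_apply, expMeasure_univ, smul_eq_mul,
    ← ENNReal.ofReal_mul (Real.exp_nonneg _), ← Real.exp_add, measureReal_nnreal_smul_apply]
  congr 2
  ring

theorem integral_poisson_semicharacter (hα : H.IsPositiveSemicharacter α) (ρ : Measure X) [IsFiniteMeasure ρ]
    [IsFiniteMeasure (weight α ρ)] (t : ℝ≥0) :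
    ∫ x, α x ∂(H.poisson ρ t) =
      Real.exp ((t : ℝ) * ((weight α ρ).real Set.univ - ρ.real Set.univ)) := by
  rw [integral_eq_lintegral_of_nonneg_ae (Eventually.of_forall fun x => (hα.pos x).le)
    hα.continuous.measurable.aestronglyMeasurable, ← weight_univ, weight_poisson_univ hα,
    ENNReal.toReal_ofReal (Real.exp_nonneg _)]

/-- Dividing by the total mass cancels `e^{-t‖ρ‖}` and leaves exactly the normalization `e^{-t‖α
ρ‖}` of the Poisson measure of `α ρ`. -/
theorem renorm_poisson (hα : H.IsPositiveSemicharacter α) (ρ : Measure X) [IsFiniteMeasure ρ]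
    [IsFiniteMeasure (weight α ρ)] (t : ℝ≥0) :
    renorm α (H.poisson ρ t) = (H.deformation hα).poisson (weight α ρ) t := by
  rw [renorm, ← weight_univ, weight_poisson_univ hα, weight_poisson hα, smul_smul, poisson,
    ← ENNReal.ofReal_inv_of_pos (Real.exp_pos _), ← Real.exp_neg,
    ← ENNReal.ofReal_mul (Real.exp_nonneg _), ← Real.exp_add]
  congr 3
  ring

theorem memM1_poisson (hα : H.IsPositiveSemicharacter α) (ρ : Measure X) [IsFiniteMeasure ρ]
    [IsFiniteMeasure (weight α ρ)] (t : ℝ≥0) : MemM1 α (H.poisson ρ t) :=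
  ⟨H.isProbabilityMeasure_poisson ρ t,
    ⟨by rw [weight_poisson_univ hα ρ]; exact ENNReal.ofReal_lt_top⟩⟩

theorem isFiniteMeasure_weight_of_poisson (ρ : Measure X) [IsFiniteMeasure ρ] {t : ℝ≥0} (ht : 0 < t)
    (h : IsFiniteMeasure (weight α (H.poisson ρ t))) : IsFiniteMeasure (weight α ρ) := by
  constructor
  rw [weight_univ, lt_top_iff_ne_top]
  intro htop
  have h1 := measure_lt_top (weight α (H.poisson ρ t)) Set.univ
  -- The term `n = 1` is `t ∫ α dρ = ∞` because `t > 0`, and the exponential prefactor is nonzero,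
  -- so the whole integral would be infinite.
  rw [weight_univ, lintegral_poisson, ENNReal.tsum_eq_top_of_eq_top ⟨1, by
    simp [convPow_one, htop, ht.ne']⟩, ENNReal.mul_top (by simp [Real.exp_pos])] at h1
  exact lt_irrefl _ h1

theorem isFiniteMeasure_weight_iff (hα : H.IsPositiveSemicharacter α) (ρ : Measure X)
    [IsFiniteMeasure ρ] :
    IsFiniteMeasure (weight α ρ) ↔
      ∀ U ∈ 𝓝 H.one, ∫⁻ x in Uᶜ, ENNReal.ofReal (α x) ∂(ρ.restrict {H.one}ᶜ) < ∞ := by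
  constructor
  · intro h U _
    refine lt_of_le_of_lt ?_ (measure_lt_top (weight α ρ) Set.univ)
    rw [weight_univ]
    exact lintegral_mono' (Measure.restrict_le_self.trans Measure.restrict_le_self) le_rfl
  · intro h
    obtain ⟨K, hK, hK1⟩ := exists_compact_mem_nhds H.one
    -- `Kᶜ` does not contain `e`, so removing the possible atom of `ρ` at `e` changes nothing there.
    have h1 : ∫⁻ x in Kᶜ, ENNReal.ofReal (α x) ∂ρ < ∞ := by
      have h2 := h K hK1
      rwa [Measure.restrict_restrict hK.measurableSet.compl, Set.inter_eq_left.2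
        (Set.compl_subset_compl.2 (Set.singleton_subset_iff.2 (mem_of_mem_nhds hK1)))] at h2
    have h3 : ∫⁻ x in K, ENNReal.ofReal (α x) ∂ρ < ∞ :=
      setLIntegral_lt_top_of_isCompact (f := fun x => (α x).toNNReal) (measure_ne_top _ _) hK
        (continuous_real_toNNReal.comp hα.continuous)
    constructor
    rw [weight_univ, ← lintegral_add_compl _ hK.measurableSet]
    exact ENNReal.add_lt_top.2 ⟨h3, h1⟩

end Deformation

end CommHypergroup

/-! ### The main theorem. -/

theorem mainTheorem2 {X : Type*} [TopologicalSpace X] [T2Space X] [LocallyCompactSpace X]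
    [SecondCountableTopology X] [MeasurableSpace X] [BorelSpace X]
    (H : CommHypergroup X) (α₀ : X → ℝ) (hα₀ : H.IsPositiveSemicharacter α₀)
    (ρ : Measure X) [IsFiniteMeasure ρ]
    (μ : ℝ≥0 → Measure X) (hμ : ∀ t, μ t = H.poisson ρ t) :
    H.IsConvolutionSemigroup μ ∧
    (∀ η : Measure X, H.IsLevyMeasure μ η ↔ η = ρ.restrict {H.one}ᶜ) ∧
    List.TFAE [
      ∃ t : ℝ≥0, 0 < t ∧ CommHypergroup.MemM1 α₀ (μ t),
      (∀ t : ℝ≥0, CommHypergroup.MemM1 α₀ (μ t)) ∧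
        (∀ t : ℝ≥0, 0 < ∫ x, α₀ x ∂(μ t)) ∧
        (Continuous fun t : ℝ≥0 => ∫ x, α₀ x ∂(μ t)) ∧
        (∀ s t : ℝ≥0, ∫ x, α₀ x ∂(μ (s + t)) = (∫ x, α₀ x ∂(μ s)) * ∫ x, α₀ x ∂(μ t)) ∧
        (H.deformation hα₀).IsConvolutionSemigroup
          (fun t => CommHypergroup.renorm α₀ (μ t)),
      ∀ U ∈ 𝓝 H.one, ∫⁻ x in Uᶜ, ENNReal.ofReal (α₀ x) ∂(ρ.restrict {H.one}ᶜ) < ∞] := by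
  obtain rfl : μ = H.poisson ρ := funext hμ
  refine ⟨H.isConvolutionSemigroup_poisson ρ, H.isLevyMeasure_poisson_iff ρ, ?_⟩
  -- Finiteness of `α₀ρ` is the pivot: it follows from 1, is equivalent to 3, and yields 2 through
  -- the explicit formulas.
  tfae_have 1 → 3 := fun ⟨t, ht, hmem⟩ =>
    (CommHypergroup.isFiniteMeasure_weight_iff hα₀ ρ).1
      (CommHypergroup.isFiniteMeasure_weight_of_poisson ρ ht hmem.2)
  tfae_have 3 → 2 := fun h => by
    have := (CommHypergroup.isFiniteMeasure_weight_iff hα₀ ρ).2 h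
    simp only [CommHypergroup.integral_poisson_semicharacter hα₀ ρ,
      CommHypergroup.renorm_poisson hα₀ ρ]
    refine ⟨CommHypergroup.memM1_poisson hα₀ ρ, fun t => Real.exp_pos _, by fun_prop, fun s t => ?_,
      (H.deformation hα₀).isConvolutionSemigroup_poisson _⟩
    rw [← Real.exp_add, NNReal.coe_add, add_mul]
  tfae_have 2 → 1 := fun h => ⟨1, one_pos, h.1 1⟩
  tfae_finish
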